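/- For a positive integer $n$ let $S_n$ be the set of permutations of $\{1,\dots,n\}$ with the metric $d_\infty(f,g)=\max_{1\le i\le n}|f(i)-g(i)|$. For an integer $r\ge 0$ let $|B_{r,n}|$ be the number of $g\in S_n$ with $d_\infty(f,g)\le r$; this number does not depend on the center $f\in S_n$. Fix a real number $\rho$ with $0<\rho\le\frac12$. Then there is a function $\varphi_3(\rho,\cdot)$ from the non-negative integers to the positive reals such that, as $n\to\infty$ (with $\rho$ fixed), $$\log_2\varphi_3(\rho,n)=n\log_2 n-n\Big[(\log_2 e-1)\cdot 2\rho-\log_2\rho-\log_2(\log_2 e)+1\Big]+o(n),$$ and $$|B_{\rho(n-1),\,n}|\ \ge\ \varphi_3(\rho,n)$$ for every positive integer $n$ for which $\rho(n-1)$ is an integer. -/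

import Mathlib

open Filter Asymptotics

/-- The infinity distance `max_i |f(i) - g(i)|` between two permutations of `n` letters.
The letters are `0, …, n-1` instead of `1, …, n`, which does not affect differences. -/
def permInfDist {n : ℕ} (f g : Equiv.Perm (Fin n)) : ℕ :=
  Finset.univ.sup fun i : Fin n => (((f i : ℕ) : ℤ) - ((g i : ℕ) : ℤ)).natAbs

/-- The ball of radius `r` centered at `f`, with respect to the infinity distance. -/
def permBall {n : ℕ} (r : ℕ) (f : Equiv.Perm (Fin n)) : Finset (Equiv.Perm (Fin n)) :=
  Finset.univ.filter fun g => permInfDist f g ≤ r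

/-!
Cut `{0, …, n - 1}` into `K` consecutive blocks of almost equal length, and let `H` be the group of
permutations that preserve every block. If a permutation `g₀` moves `M a b` points from block `a` to
block `b`, then the double coset `H g₀ H` consists of permutations with the same block counts and
has `(∏ n_a!) ^ 2 / ∏ M a b!` elements, where `n_a` is the size of block `a`
(`sq_prod_factorial_le_card_mul`). If `M a b = 0` for `|a - b| > L` and `L + 1 ≤ ρ K`, it lies in
the ball of radius `ρ (n - 1)` around the identity. Every matrix with the right row and column sums
occurs (`exists_perm_card_pair_eq`); rounding `n / K` times a symmetric stochastic matrix `W` with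
this band and applying Stirling's formula gives
`log |B| ≥ n log n - n (1 + log K + (∑ W log W) / K) - o(n)` (`eventually_le_log_card_permBall`).

It remains to choose `W`. With `β ^ L = 2`, take `W a b` proportional to `β ^ |a - b|` on the band,
off the diagonal, and in the two corners of size `L` proportional to `β ^ e`, where `e` is the
distance from `a` to the mirror image of `b` in the inner edge of the corner. The row sums are then
exactly equal, and the entropy has a closed form (`sum_bandKernel_mul_log`). Letting `K → ∞` with
`L / K → ρ` yields the constant of the theorem (`tendsto_band_entropy`).
-/

/-! ### Permutations with prescribed block counts -/

/-- A matrix of natural numbers whose row and column sums are the fiber sizes of the coloring `c`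
is the transition matrix of some permutation: `M a b` counts the points that a permutation moves
from color `a` to color `b`. -/
theorem exists_perm_card_pair_eq {α κ : Type*} [Fintype α] [Fintype κ] [DecidableEq κ]
    (c : α → κ) (M : κ → κ → ℕ)
    (hrow : ∀ a, ∑ b, M a b = Fintype.card {i // c i = a})
    (hcol : ∀ b, ∑ a, M a b = Fintype.card {i // c i = b}) :
    ∃ g : Equiv.Perm α, ∀ p : κ × κ,
      Fintype.card {i // (c i, c (g i)) = p} = M p.1 p.2 := by
  classical
  -- `Ω` has `M a b` points of type `(a, b)`. Matching it with `α` once by first and once by second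
  -- coordinate gives the two bijections whose quotient is the required permutation.
  let Ω := Σ p : κ × κ, Fin (M p.1 p.2)
  have h₁ : ∀ a, Nonempty ({ω : Ω // ω.1.1 = a} ≃ {i // c i = a}) := fun a => by
    let e : {ω : Ω // ω.1.1 = a} ≃ Σ b, Fin (M a b) :=
      { toFun := fun ω => ⟨ω.1.1.2, Fin.cast (by rw [ω.2]) ω.1.2⟩
        invFun := fun x => ⟨⟨(a, x.1), x.2⟩, rfl⟩
        left_inv := by rintro ⟨⟨⟨a', b⟩, k⟩, rfl⟩; rfl
        right_inv := fun _ => rfl }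
    rw [← Fintype.card_eq, Fintype.card_congr e, Fintype.card_sigma, ← hrow a]
    simp
  have h₂ : ∀ b, Nonempty ({ω : Ω // ω.1.2 = b} ≃ {i // c i = b}) := fun b => by
    let e : {ω : Ω // ω.1.2 = b} ≃ Σ a, Fin (M a b) :=
      { toFun := fun ω => ⟨ω.1.1.1, Fin.cast (by rw [ω.2]) ω.1.2⟩
        invFun := fun x => ⟨⟨(x.1, b), x.2⟩, rfl⟩
        left_inv := by rintro ⟨⟨⟨a', b⟩, k⟩, rfl⟩; rfl
        right_inv := fun _ => rfl }
    rw [← Fintype.card_eq, Fintype.card_congr e, Fintype.card_sigma, ← hcol b]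
    simp
  let E₁ : Ω ≃ α := Equiv.ofFiberEquiv fun a => (h₁ a).some
  let E₂ : Ω ≃ α := Equiv.ofFiberEquiv fun b => (h₂ b).some
  have hE₁ : ∀ ω, c (E₁ ω) = ω.1.1 := Equiv.ofFiberEquiv_map _
  have hE₂ : ∀ ω, c (E₂ ω) = ω.1.2 := Equiv.ofFiberEquiv_map _
  refine ⟨E₁.symm.trans E₂, fun p => ?_⟩
  have e : {ω : Ω // ω.1 = p} ≃ {i // (c i, c ((E₁.symm.trans E₂) i)) = p} :=
    E₁.subtypeEquiv fun ω => by simp [hE₁, hE₂]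
  rw [← Fintype.card_congr e, Fintype.card_congr (Equiv.sigmaSubtype p), Fintype.card_fin]

/-- If `S` contains the double coset `H g₀ H` of the stabilizer `H` of a coloring `c`, then
`|H| ^ 2 ≤ |H ∩ g₀⁻¹ H g₀| * |S|`. The group `H` is a product of symmetric groups on the color
classes, and `H ∩ g₀⁻¹ H g₀` is the stabilizer of the coloring by pairs `(c i, c (g₀ i))`. -/
theorem sq_prod_factorial_le_card_mul {α κ : Type*} [Fintype α] [DecidableEq α]
    [Fintype κ] [DecidableEq κ] (c : α → κ) (g₀ : Equiv.Perm α) (S : Finset (Equiv.Perm α))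
    (hS : ∀ h k : Equiv.Perm α, c ∘ h = c → c ∘ k = c → h * g₀ * k ∈ S) :
    (∏ a, (Fintype.card {i // c i = a}).factorial) ^ 2 ≤
      (∏ p : κ × κ, (Fintype.card {i // (c i, c (g₀ i)) = p}).factorial) * S.card := by
  classical
  rw [← DomMulAct.stabilizer_card c, ← DomMulAct.stabilizer_card (fun i => (c i, c (g₀ i))), sq,
    ← Fintype.card_prod, ← Finset.card_univ]
  -- Every fiber of `(h, k) ↦ h * g₀ * k` embeds into the stabilizer of the pair coloring.
  refine Finset.card_le_mul_card_image_of_maps_to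
    (f := fun x : {g : Equiv.Perm α // c ∘ g = c} × {g : Equiv.Perm α // c ∘ g = c} =>
      x.1.1 * g₀ * x.2.1) (fun x _ => hS _ _ x.1.2 x.2.2) _ fun g _ => ?_
  rw [← Finset.card_univ]
  obtain h0 | ⟨⟨h', k'⟩, hx'⟩ := Finset.eq_empty_or_nonempty
    ({x : {g : Equiv.Perm α // c ∘ g = c} × {g : Equiv.Perm α // c ∘ g = c} |
      x.1.1 * g₀ * x.2.1 = g} : Finset _)
  · simp [h0]
  simp only [Finset.mem_filter, Finset.mem_univ, true_and] at hx'
  have hc : ∀ h : {g : Equiv.Perm α // c ∘ g = c}, ∀ i, c (h.1 i) = c i :=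
    fun h i => congrFun h.2 i
  have hci : ∀ h : {g : Equiv.Perm α // c ∘ g = c}, ∀ i, c (h.1⁻¹ i) = c i :=
    fun h i => by rw [← hc h]; simp
  -- The embedding is `(h, k) ↦ k * k'⁻¹`; `key` shows that the junk branch is never taken.
  refine Finset.card_le_card_of_injOn
    (fun x => if hx : (fun i => (c i, c (g₀ i))) ∘ (x.2.1 * k'.1⁻¹) =
      (fun i => (c i, c (g₀ i))) then ⟨x.2.1 * k'.1⁻¹, hx⟩ else ⟨1, rfl⟩)
    (fun _ _ => Finset.mem_coe.2 (Finset.mem_univ _)) ?_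
  have key : ∀ x : {g : Equiv.Perm α // c ∘ g = c} × {g : Equiv.Perm α // c ∘ g = c},
      x.1.1 * g₀ * x.2.1 = g → (fun i => (c i, c (g₀ i))) ∘ (x.2.1 * k'.1⁻¹) =
      (fun i => (c i, c (g₀ i))) := by
    intro x hx
    have h2 : g₀ * (x.2.1 * k'.1⁻¹) = x.1.1⁻¹ * h'.1 * g₀ := by
      rw [← hx'] at hx
      calc g₀ * (x.2.1 * k'.1⁻¹) = x.1.1⁻¹ * (x.1.1 * g₀ * x.2.1) * k'.1⁻¹ := by group
        _ = _ := by rw [hx]; group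
    funext i
    have h3 : g₀ (x.2.1 (k'.1⁻¹ i)) = x.1.1⁻¹ (h'.1 (g₀ i)) := congrArg (fun e => e i) h2
    simp only [Function.comp_apply, Equiv.Perm.coe_mul, h3, hc, hci]
  rintro x hx y hy hxy
  simp only [Finset.coe_filter, Finset.mem_univ, true_and, Set.mem_ofPred_eq] at hx hy
  simp only [key x hx, key y hy, dite_true, Subtype.mk.injEq, mul_left_inj] at hxy
  have h1 : x.1.1 = y.1.1 := by
    rw [← hy, hxy] at hx
    exact mul_right_cancel (mul_right_cancel hx)
  exact Prod.ext (Subtype.ext h1) (Subtype.ext hxy)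

/-! ### Balls of permutations -/

/-- The distance is right-invariant, so all balls of one radius have the same size. -/
theorem card_permBall_eq {n : ℕ} (r : ℕ) (f : Equiv.Perm (Fin n)) :
    (permBall r f).card = (permBall r (1 : Equiv.Perm (Fin n))).card := by
  refine Finset.card_bij' (fun g _ => g * f⁻¹) (fun g _ => g * f) ?_ ?_ ?_ ?_
  · intro g hg
    simp only [permBall, permInfDist, Finset.mem_filter, Finset.mem_univ, true_and,
      Finset.sup_le_iff, forall_const] at hg ⊢
    intro i
    simpa using hg (f⁻¹ i)
  · intro g hg
    simp only [permBall, permInfDist, Finset.mem_filter, Finset.mem_univ, true_and,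
      Finset.sup_le_iff, forall_const] at hg ⊢
    intro i
    simpa using hg (f i)
  · intro g _; simp
  · intro g _; simp

theorem mem_permBall_one {n r : ℕ} (g : Equiv.Perm (Fin n)) :
    g ∈ permBall r (1 : Equiv.Perm (Fin n)) ↔
      ∀ i : Fin n, (((i : ℕ) : ℤ) - ((g i : ℕ) : ℤ)).natAbs ≤ r := by
  simp [permBall, permInfDist]

/-! ### Factorials at linear scale -/

theorem log_factorial_le (k : ℕ) :
    Real.log k.factorial ≤ k * Real.log k - k + 2 * √((k : ℝ) + 1) + 1 := by
  obtain rfl | hk := Nat.eq_zero_or_pos k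
  · simp; norm_num
  obtain ⟨j, rfl⟩ : ∃ j, k = j + 1 := ⟨k - 1, by omega⟩
  have h := Stirling.log_stirlingSeq'_antitone (Nat.zero_le j)
  simp only [Function.comp_apply, Stirling.log_stirlingSeq_formula, Nat.succ_eq_add_one,
    zero_add, Nat.factorial_one, Nat.cast_one, Real.log_one] at h
  set x : ℝ := ((j + 1 : ℕ) : ℝ) with hx
  have hx1 : 1 ≤ x := by rw [hx]; exact_mod_cast hk
  have h2 : Real.log x ≤ 2 * √(x + 1) := by
    have := Real.log_le_sub_one_of_pos (Real.sqrt_pos.2 (by linarith : 0 < x))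
    rw [Real.log_sqrt (by linarith)] at this
    have h3 : √x ≤ √(x + 1) := Real.sqrt_le_sqrt (by linarith)
    linarith
  have h4 : 0 ≤ √(x + 1) := Real.sqrt_nonneg _
  rw [Real.log_mul (by norm_num) (by linarith), Real.log_div (by linarith) (Real.exp_pos 1).ne',
    Real.log_div one_ne_zero (Real.exp_pos 1).ne', Real.log_exp, Real.log_one] at h
  simp only [mul_one] at h
  linarith

theorem le_log_factorial (k : ℕ) : k * Real.log k - k ≤ Real.log k.factorial := by
  obtain rfl | hk := Nat.eq_zero_or_pos k
  · simp
  have h := Stirling.le_log_factorial_stirling hk.ne'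
  have h1 : 0 ≤ Real.log k := Real.log_nonneg (by exact_mod_cast hk)
  have h2 : 0 ≤ Real.log (2 * Real.pi) := Real.log_nonneg (by linarith [Real.pi_gt_three])
  linarith

/-- Stirling's formula at linear scale; `p = 0` is allowed, by continuity of `x * log x`. -/
theorem tendsto_log_factorial_sub {k : ℕ → ℕ} {p : ℝ}
    (h : Tendsto (fun n : ℕ => (k n : ℝ) / n) atTop (nhds p)) :
    Tendsto (fun n : ℕ => (Real.log (k n).factorial - k n * Real.log n) / n) atTop
      (nhds (p * Real.log p - p)) := by
  have h0 : Tendsto (fun n : ℕ => (1 : ℝ) / n) atTop (nhds 0) :=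
    tendsto_one_div_atTop_nhds_zero_nat
  have hlow : Tendsto (fun n : ℕ => (k n : ℝ) / n * Real.log ((k n : ℝ) / n) - (k n : ℝ) / n)
      atTop (nhds (p * Real.log p - p)) :=
    ((Real.continuous_mul_log.tendsto p).comp h).sub h
  have hsq : Tendsto (fun n : ℕ => √(((k n : ℝ) / n + 1 / n) * (1 / n))) atTop (nhds 0) := by
    have := (Real.continuous_sqrt.tendsto _).comp ((h.add h0).mul h0)
    rw [add_zero, mul_zero, Real.sqrt_zero] at this
    exact this
  have hup := (hlow.add (hsq.const_mul 2)).add h0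
  have hid : ∀ n : ℕ, 0 < n → (k n : ℝ) / n * Real.log ((k n : ℝ) / n) - (k n : ℝ) / n =
      (k n * Real.log (k n) - k n - k n * Real.log n) / n := by
    intro n hn
    have hn' : (n : ℝ) ≠ 0 := by positivity
    obtain hk | hk := Nat.eq_zero_or_pos (k n)
    · simp [hk]
    · rw [Real.log_div (by positivity) hn']
      field_simp
      ring
  rw [mul_zero, add_zero, add_zero] at hup
  refine tendsto_of_tendsto_of_tendsto_of_le_of_le' hlow hup ?_ ?_
  · filter_upwards [eventually_gt_atTop 0] with n hn
    rw [hid n hn]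
    gcongr
    exact le_log_factorial _
  · filter_upwards [eventually_gt_atTop 0] with n hn
    have hn' : (0 : ℝ) < n := by positivity
    have hs : √(((k n : ℝ) / n + 1 / n) * (1 / n)) = √((k n : ℝ) + 1) / n := by
      rw [← add_div, div_mul_div_comm, mul_one, Real.sqrt_div' _ (by positivity),
        Real.sqrt_mul_self hn'.le]
    rw [hid n hn, hs, ← mul_div_assoc, ← add_div, ← add_div]
    gcongr
    linarith [log_factorial_le (k n)]

theorem tendsto_div_of_abs_sub_le {u : ℕ → ℝ} {p C : ℝ}
    (h : ∀ᶠ n : ℕ in atTop, |u n - p * n| ≤ C) :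
    Tendsto (fun n : ℕ => u n / n) atTop (nhds p) := by
  rw [tendsto_iff_norm_sub_tendsto_zero]
  refine squeeze_zero' (.of_forall fun _ => norm_nonneg _) ?_
    (tendsto_const_div_atTop_nhds_zero_nat C)
  filter_upwards [h, eventually_gt_atTop 0] with n hn hn0
  have hn' : (0 : ℝ) < n := by positivity
  have : u n / n - p = (u n - p * n) / n := by field_simp
  rw [this, Real.norm_eq_abs, abs_div, abs_of_pos hn']
  gcongr

/-! ### The entropy bound -/

/-- The partition of `n` points into `K` consecutive intervals of almost equal length. -/
def blockIndex {K : ℕ} (hK : 0 < K) (n : ℕ) (i : Fin n) : Fin K :=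
  ⟨i * K / n, Nat.div_lt_of_lt_mul (Nat.mul_lt_mul_of_pos_right i.2 hK)⟩

theorem abs_card_blockIndex_sub_le {K : ℕ} (hK : 0 < K) {n : ℕ} (hn : 0 < n) (a : Fin K) :
    |(Fintype.card {i // blockIndex hK n i = a} : ℝ) - 1 / K * n| ≤ 1 := by
  have hK' : (0 : ℝ) < K := by positivity
  have hn' : (0 : ℝ) < n := by positivity
  set s : ℝ := (a : ℕ) * n / K with hs
  set t : ℝ := ((a : ℕ) + 1) * n / K with ht
  have hst : t - s = 1 / K * n := by rw [hs, ht]; ring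
  have hs0 : 0 ≤ s := by positivity
  have ht0 : 0 ≤ t := by positivity
  have hle : s ≤ t := by rw [← sub_nonneg, hst]; positivity
  have htn : t ≤ n := by
    rw [ht, div_le_iff₀ hK', mul_comm (n : ℝ)]
    gcongr
    exact_mod_cast a.2
  have hcard : Fintype.card {i // blockIndex hK n i = a} = ⌈t⌉₊ - ⌈s⌉₊ := by
    rw [← Nat.card_Ico, Fintype.card_subtype]
    refine Finset.card_bij (fun i _ => (i : ℕ)) ?_ (fun _ _ _ _ h => Fin.ext h) ?_
    · intro i hi
      simp only [Finset.mem_filter, Finset.mem_univ, true_and, blockIndex, Fin.ext_iff,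
        Nat.div_eq_iff hn] at hi
      rw [Finset.mem_Ico, Nat.ceil_le, Nat.lt_ceil, hs, ht, div_le_iff₀ hK', lt_div_iff₀ hK']
      have h1 : (a : ℕ) * n ≤ i * K := by omega
      have h2 : i * K < ((a : ℕ) + 1) * n := by rw [add_mul]; omega
      exact ⟨by exact_mod_cast h1, by exact_mod_cast h2⟩
    · intro j hj
      rw [Finset.mem_Ico, Nat.ceil_le, Nat.lt_ceil] at hj
      have hjn : j < n := by exact_mod_cast hj.2.trans_le htn
      refine ⟨⟨j, hjn⟩, ?_, rfl⟩
      rw [hs, ht, div_le_iff₀ hK', lt_div_iff₀ hK'] at hj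
      have h1 : (a : ℕ) * n ≤ j * K := by exact_mod_cast hj.1
      have h2 : j * K < ((a : ℕ) + 1) * n := by exact_mod_cast hj.2
      rw [add_mul] at h2
      simp only [Finset.mem_filter, Finset.mem_univ, true_and, blockIndex, Fin.ext_iff,
        Nat.div_eq_iff hn]
      omega
  rw [hcard, Nat.cast_sub (Nat.ceil_mono hle), ← hst, abs_le]
  constructor <;>
  linarith [Nat.le_ceil s, Nat.le_ceil t, Nat.ceil_lt_add_one hs0, Nat.ceil_lt_add_one ht0]

/-- Points in blocks at distance at most `L` differ by less than `(L + 1) * n / K ≤ ρ * n`, which is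
less than `r + 1` for `r = ρ * (n - 1)`. -/
theorem natAbs_sub_le_of_blockIndex {K : ℕ} (hK : 0 < K) {n r L : ℕ} {ρ : ℝ} (hρ : ρ ≤ 1)
    (hL : (L : ℝ) + 1 ≤ ρ * K) (hr : (r : ℝ) = ρ * ((n : ℝ) - 1)) (i j : Fin n)
    (h : |((blockIndex hK n i : ℕ) : ℤ) - ((blockIndex hK n j : ℕ) : ℤ)| ≤ L) :
    (((i : ℕ) : ℤ) - ((j : ℕ) : ℤ)).natAbs ≤ r := by
  have hn : 0 < n := i.pos
  have key : ∀ i j : Fin n,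
      ((blockIndex hK n i : ℕ) : ℤ) - ((blockIndex hK n j : ℕ) : ℤ) ≤ L →
      ((i : ℕ) : ℤ) - ((j : ℕ) : ℤ) ≤ r := by
    intro i j h
    have h1 : (i : ℕ) * K < ((i : ℕ) * K / n + 1) * n := by
      rw [← Nat.div_lt_iff_lt_mul hn]; omega
    have h2 : (j : ℕ) * K / n * n ≤ j * K := Nat.div_mul_le_self _ _
    simp only [blockIndex] at h
    have h3 : (i : ℕ) * K / n ≤ (j : ℕ) * K / n + L := by omega
    have h4 : (i : ℕ) * K < j * K + (L + 1) * n := by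
      calc (i : ℕ) * K < ((i : ℕ) * K / n + 1) * n := h1
        _ ≤ ((j : ℕ) * K / n + L + 1) * n := by gcongr
        _ = (j : ℕ) * K / n * n + (L + 1) * n := by ring
        _ ≤ _ := by gcongr
    have h5 : ((i : ℕ) : ℝ) * K < (j : ℕ) * K + (L + 1) * n := by exact_mod_cast h4
    have hK' : (0 : ℝ) < K := by positivity
    have h6 : ((L : ℝ) + 1) * n ≤ ρ * K * n := by gcongr
    have h7 : (((i : ℕ) : ℝ) - (j : ℕ)) * K < (r + ρ) * K := by
      rw [hr]; nlinarith
    have h8 : ((i : ℕ) : ℝ) - (j : ℕ) < r + ρ := lt_of_mul_lt_mul_right h7 hK'.le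
    have h9 : ((i : ℕ) : ℝ) < (j : ℕ) + r + 1 := by linarith
    have h10 : (i : ℕ) < j + r + 1 := by exact_mod_cast h9
    omega
  have h1 := key i j (abs_le.1 h).2
  have h2 := key j i (by have := (abs_le.1 h).1; omega)
  omega

/-- An integral version of `n / K` times a symmetric stochastic matrix `W`. Off-diagonal entries are
rounded down, and the diagonal entry is whatever makes the row sum equal to the block size. Scaling
by `n - K` in place of `n` leaves room for the blocks being up to one point smaller than `n / K`, so
that the subtraction on the diagonal does not truncate once `K ≤ n`. -/
noncomputable def blockCounts {K : ℕ} (hK : 0 < K) (W : Fin K → Fin K → ℝ) (n : ℕ)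
    (a b : Fin K) : ℕ :=
  if a = b then
    Fintype.card {i // blockIndex hK n i = a} -
      ∑ b' ∈ Finset.univ.erase a, ⌊W a b' / K * ((n : ℝ) - K)⌋₊
  else ⌊W a b / K * ((n : ℝ) - K)⌋₊

theorem sum_floor_le_card {K : ℕ} (hK : 0 < K) {W : Fin K → Fin K → ℝ}
    (hW : ∀ a b, 0 ≤ W a b) (hrow : ∀ a, ∑ b, W a b = 1) {n : ℕ} (hn : K ≤ n) (a : Fin K) :
    ∑ b ∈ Finset.univ.erase a, ⌊W a b / K * ((n : ℝ) - K)⌋₊ ≤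
      Fintype.card {i // blockIndex hK n i = a} := by
  have hK' : (0 : ℝ) < K := by positivity
  have hn' : (0 : ℝ) ≤ (n : ℝ) - K := by rw [sub_nonneg]; exact_mod_cast hn
  have h1 : (∑ b ∈ Finset.univ.erase a, (⌊W a b / K * ((n : ℝ) - K)⌋₊ : ℝ)) ≤
      1 / K * n - 1 := by
    calc _ ≤ ∑ b, (⌊W a b / K * ((n : ℝ) - K)⌋₊ : ℝ) :=
          Finset.sum_le_sum_of_subset_of_nonneg (Finset.subset_univ _) fun _ _ _ => by positivity
      _ ≤ ∑ b, W a b / K * ((n : ℝ) - K) := Finset.sum_le_sum fun b _ =>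
          Nat.floor_le (mul_nonneg (div_nonneg (hW a b) hK'.le) hn')
      _ = _ := by
          rw [← Finset.sum_mul, ← Finset.sum_div, hrow]
          field_simp
  have h2 := (abs_le.1 (abs_card_blockIndex_sub_le hK (hK.trans_le hn) a)).1
  have h3 : (∑ b ∈ Finset.univ.erase a, (⌊W a b / K * ((n : ℝ) - K)⌋₊ : ℝ)) ≤
      Fintype.card {i // blockIndex hK n i = a} := by linarith
  exact_mod_cast h3

theorem sum_blockCounts {K : ℕ} (hK : 0 < K) {W : Fin K → Fin K → ℝ}
    (hW : ∀ a b, 0 ≤ W a b) (hrow : ∀ a, ∑ b, W a b = 1) {n : ℕ} (hn : K ≤ n) (a : Fin K) :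
    ∑ b, blockCounts hK W n a b = Fintype.card {i // blockIndex hK n i = a} := by
  rw [← Finset.add_sum_erase _ _ (Finset.mem_univ a)]
  have : ∑ b ∈ Finset.univ.erase a, blockCounts hK W n a b =
      ∑ b ∈ Finset.univ.erase a, ⌊W a b / K * ((n : ℝ) - K)⌋₊ :=
    Finset.sum_congr rfl fun b hb => if_neg (Finset.ne_of_mem_erase hb).symm
  rw [this, blockCounts, if_pos rfl]
  exact Nat.sub_add_cancel (sum_floor_le_card hK hW hrow hn a)

theorem blockCounts_comm {K : ℕ} (hK : 0 < K) {W : Fin K → Fin K → ℝ}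
    (hsymm : ∀ a b, W a b = W b a) (n : ℕ) (a b : Fin K) :
    blockCounts hK W n a b = blockCounts hK W n b a := by
  obtain rfl | hab := eq_or_ne a b
  · rfl
  · rw [blockCounts, blockCounts, if_neg hab, if_neg hab.symm, hsymm]

theorem tendsto_card_blockIndex_div {K : ℕ} (hK : 0 < K) (a : Fin K) :
    Tendsto (fun n : ℕ => (Fintype.card {i // blockIndex hK n i = a} : ℝ) / n) atTop
      (nhds (1 / K)) :=
  tendsto_div_of_abs_sub_le (C := 1) <| by
    filter_upwards [eventually_gt_atTop 0] with n hn
    exact abs_card_blockIndex_sub_le hK hn a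

theorem tendsto_floor_div {K : ℕ} (hK : 0 < K) {W : Fin K → Fin K → ℝ}
    (hW : ∀ a b, 0 ≤ W a b) (a b : Fin K) :
    Tendsto (fun n : ℕ => (⌊W a b / K * ((n : ℝ) - K)⌋₊ : ℝ) / n) atTop
      (nhds (W a b / K)) := by
  have hK' : (0 : ℝ) < K := by positivity
  refine tendsto_div_of_abs_sub_le (C := 1 + W a b) ?_
  filter_upwards [eventually_ge_atTop K] with n hn
  have hn' : (0 : ℝ) ≤ (n : ℝ) - K := by rw [sub_nonneg]; exact_mod_cast hn
  have h0 : 0 ≤ W a b / K * ((n : ℝ) - K) := mul_nonneg (div_nonneg (hW a b) hK'.le) hn'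
  have h1 := Nat.floor_le h0
  have h2 := Nat.lt_floor_add_one (W a b / K * ((n : ℝ) - K))
  have h3 : W a b / K * ((n : ℝ) - K) = W a b / K * n - W a b := by field_simp
  rw [abs_le]
  constructor <;> linarith [hW a b]

theorem tendsto_blockCounts_div {K : ℕ} (hK : 0 < K) {W : Fin K → Fin K → ℝ}
    (hW : ∀ a b, 0 ≤ W a b) (hrow : ∀ a, ∑ b, W a b = 1) (a b : Fin K) :
    Tendsto (fun n : ℕ => (blockCounts hK W n a b : ℝ) / n) atTop (nhds (W a b / K)) := by
  obtain rfl | hab := eq_or_ne a b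
  · have h := (tendsto_card_blockIndex_div hK a).sub
      (tendsto_finsetSum (Finset.univ.erase a) fun b _ => tendsto_floor_div hK hW a b)
    have hlim : 1 / (K : ℝ) - ∑ b ∈ Finset.univ.erase a, W a b / K = W a a / K := by
      rw [← Finset.sum_div, ← hrow a, ← Finset.add_sum_erase _ _ (Finset.mem_univ a)]
      ring
    rw [hlim] at h
    refine h.congr' ?_
    filter_upwards [eventually_ge_atTop K] with n hn
    rw [blockCounts, if_pos rfl, Nat.cast_sub (sum_floor_le_card hK hW hrow hn a), Nat.cast_sum,
      ← Finset.sum_div, sub_div]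
  · simp only [blockCounts, if_neg hab]
    exact tendsto_floor_div hK hW a b

/-- A symmetric stochastic matrix `W` supported on the band `|a - b| ≤ L` bounds the size of the
ball from below through its entropy. -/
theorem eventually_le_log_card_permBall {K : ℕ} (hK : 0 < K) {W : Fin K → Fin K → ℝ}
    (hW : ∀ a b, 0 ≤ W a b) (hrow : ∀ a, ∑ b, W a b = 1) (hsymm : ∀ a b, W a b = W b a) {L : ℕ}
    (hsupp : ∀ a b : Fin K, W a b ≠ 0 → |((a : ℕ) : ℤ) - ((b : ℕ) : ℤ)| ≤ L)
    {ρ : ℝ} (hρ : ρ ≤ 1) (hL : (L : ℝ) + 1 ≤ ρ * K) {δ : ℝ} (hδ : 0 < δ) :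
    ∀ᶠ n : ℕ in atTop, ∀ r : ℕ, (r : ℝ) = ρ * ((n : ℝ) - 1) →
      n * Real.log n - n * (1 + Real.log K + (∑ a, ∑ b, W a b * Real.log (W a b)) / K + δ) ≤
        Real.log (permBall r (1 : Equiv.Perm (Fin n))).card := by
  have hK' : (0 : ℝ) < K := by positivity
  have h1 := tendsto_finsetSum Finset.univ fun (a : Fin K) _ =>
    (tendsto_log_factorial_sub (tendsto_card_blockIndex_div hK a)).const_mul 2
  have h2 := tendsto_finsetSum Finset.univ fun (a : Fin K) _ =>
    tendsto_finsetSum Finset.univ fun (b : Fin K) _ =>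
      tendsto_log_factorial_sub (tendsto_blockCounts_div hK hW hrow a b)
  have h3 := h1.sub h2
  have hlim : ∑ _a : Fin K, 2 * (1 / (K : ℝ) * Real.log (1 / K) - 1 / K) -
      ∑ a, ∑ b, (W a b / K * Real.log (W a b / K) - W a b / K) =
      -(1 + Real.log K + (∑ a, ∑ b, W a b * Real.log (W a b)) / K) := by
    have h4 : ∀ a b, W a b / K * Real.log (W a b / K) - W a b / K =
        W a b * Real.log (W a b) / K - (Real.log K + 1) / K * W a b := by
      intro a b
      obtain h0 | h0 := eq_or_ne (W a b) 0
      · simp [h0]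
      · rw [Real.log_div h0 hK'.ne']; ring
    simp only [h4, Finset.sum_sub_distrib, ← Finset.mul_sum, ← Finset.sum_div, hrow,
      Finset.sum_const, Finset.card_univ, Fintype.card_fin, nsmul_eq_mul, one_div, Real.log_inv]
    field_simp
    ring
  rw [hlim] at h3
  filter_upwards [h3.eventually (lt_mem_nhds (by linarith :
    -(1 + Real.log K + (∑ a, ∑ b, W a b * Real.log (W a b)) / K) - δ < _)),
    eventually_ge_atTop K] with n hn hKn r hr
  have hn0 : (0 : ℝ) < n := by exact_mod_cast hK.trans_le hKn
  have hrowM := sum_blockCounts hK hW hrow hKn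
  have hcolM : ∀ b, ∑ a, blockCounts hK W n a b =
      Fintype.card {i // blockIndex hK n i = b} := fun b => by
    rw [← hrowM b]
    exact Finset.sum_congr rfl fun a _ => blockCounts_comm hK hsymm n a b
  have hsum : ∑ a, Fintype.card {i // blockIndex hK n i = a} = n := by
    rw [← Fintype.card_sigma, Fintype.card_congr (Equiv.sigmaFiberEquiv (blockIndex hK n)),
      Fintype.card_fin]
  obtain ⟨g₀, hg₀⟩ :=
    exists_perm_card_pair_eq (blockIndex hK n) (blockCounts hK W n) hrowM hcolM
  have hcard := sq_prod_factorial_le_card_mul (blockIndex hK n) g₀ (permBall r 1)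
      fun h k hh hk => by
    rw [mem_permBall_one]
    intro i
    have hc : blockIndex hK n ((h * g₀ * k) i) = blockIndex hK n (g₀ (k i)) :=
      congrFun hh (g₀ (k i))
    have hc' : blockIndex hK n (k i) = blockIndex hK n i := congrFun hk i
    refine natAbs_sub_le_of_blockIndex hK hρ hL hr _ _ ?_
    rw [hc, ← hc']
    set a := blockIndex hK n (k i) with ha
    set b := blockIndex hK n (g₀ (k i)) with hb
    have hpos : 0 < blockCounts hK W n a b := by
      rw [← hg₀ (a, b)]
      exact Fintype.card_pos_iff.2 ⟨⟨k i, rfl⟩⟩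
    -- Diagonal counts may be positive where `W` vanishes, but the diagonal lies in the band.
    obtain hab | hab := eq_or_ne a b
    · simp [hab]
    · refine hsupp a b fun h0 => ?_
      simp [blockCounts, if_neg hab, h0] at hpos
  simp only [hg₀, Fintype.prod_prod_type] at hcard
  have hpos : (0 : ℝ) < (permBall r (1 : Equiv.Perm (Fin n))).card := by
    have : (1 : Equiv.Perm (Fin n)) ∈ permBall r (1 : Equiv.Perm (Fin n)) := by
      simp [mem_permBall_one]
    exact_mod_cast Finset.card_pos.2 ⟨_, this⟩
  have hfac : ∀ k : ℕ, (k.factorial : ℝ) ≠ 0 := fun k => by positivity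
  have hlog : 2 * ∑ a, Real.log (Fintype.card {i // blockIndex hK n i = a}).factorial ≤
      ∑ a, ∑ b, Real.log (blockCounts hK W n a b).factorial +
        Real.log (permBall r (1 : Equiv.Perm (Fin n))).card := by
    have h := Real.log_le_log (by positivity) (Nat.cast_le (α := ℝ).2 hcard)
    push_cast at h
    rw [Real.log_pow, Real.log_mul (by positivity) hpos.ne', Real.log_prod fun _ _ => hfac _,
      Real.log_prod fun _ _ => Finset.prod_ne_zero_iff.2 fun _ _ => hfac _] at h
    simpa only [Real.log_prod fun _ _ => hfac _, Nat.cast_ofNat] using h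
  have hs1 : ∑ a, (Fintype.card {i // blockIndex hK n i = a} : ℝ) = n := by exact_mod_cast hsum
  have hs2 : ∑ a, ∑ b, (blockCounts hK W n a b : ℝ) = n := by
    rw [← hs1]
    exact Finset.sum_congr rfl fun a _ => by exact_mod_cast hrowM a
  simp only [← Finset.mul_sum, ← Finset.sum_div, Finset.sum_sub_distrib, ← Finset.sum_mul,
    hs1, hs2] at hn
  rw [← mul_div_assoc, ← sub_div, lt_div_iff₀ hn0] at hn
  linarith

/-! ### Band matrices with reflected corners -/

/-- The `K × K` matrix, indexed by natural numbers below `K`, whose entries on the band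
`0 < |a - b| ≤ L` are `f |a - b|`, except in the two corner blocks of size `L`, where the entry is
`f (i + j + 1)` with `i` and `j` the distances of `a` and `b` from the inner edge of the corner.
There `i + j + 1` is the distance from `a` to the mirror image of `b` in the inner edge of the
corner. The diagonal vanishes outside the corners. -/
noncomputable def bandKernel (K L : ℕ) (f : ℕ → ℝ) (a b : ℕ) : ℝ :=
  if a < L ∧ b < L then f ((L - 1 - a) + (L - 1 - b) + 1)
  else if K ≤ a + L ∧ K ≤ b + L then f ((a + L - K) + (b + L - K) + 1)
  else if a = b ∨ L < (a - b) + (b - a) then 0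
  else f ((a - b) + (b - a))

theorem bandKernel_comm (K L : ℕ) (f : ℕ → ℝ) (a b : ℕ) :
    bandKernel K L f a b = bandKernel K L f b a := by
  simp only [bandKernel, and_comm, eq_comm (a := a) (b := b), add_comm (a - b),
    add_comm (L - 1 - a), add_comm (a + L - K)]

theorem bandKernel_nonneg {K L : ℕ} {f : ℕ → ℝ} (hf : ∀ t, 0 ≤ f t) (a b : ℕ) :
    0 ≤ bandKernel K L f a b := by
  unfold bandKernel
  split_ifs <;> first | exact hf _ | exact le_rfl

theorem map_bandKernel {K L : ℕ} {f : ℕ → ℝ} {g : ℝ → ℝ} (hg : g 0 = 0) (a b : ℕ) :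
    g (bandKernel K L f a b) = bandKernel K L (fun t => g (f t)) a b := by
  unfold bandKernel
  split_ifs <;> simp [hg]

theorem abs_sub_le_of_bandKernel_ne_zero {K L : ℕ} {f : ℕ → ℝ} {a b : ℕ} (ha : a < K)
    (hb : b < K) (h : bandKernel K L f a b ≠ 0) : |(a : ℤ) - b| ≤ L := by
  rw [abs_le]
  unfold bandKernel at h
  split_ifs at h <;> first | omega | exact absurd rfl h

theorem bandKernel_reflect {K L : ℕ} (hKL : 2 * L ≤ K) (f : ℕ → ℝ) {a b : ℕ} (ha : a < K)
    (hb : b < K) :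
    bandKernel K L f (K - 1 - a) (K - 1 - b) = bandKernel K L f a b := by
  unfold bandKernel
  split_ifs <;> first | omega | (congr 1; omega) | rfl

/-- A row at distance `i` from the inner edge of the first corner: the first sum is the part inside
the corner, the second the part outside. -/
theorem sum_bandKernel_left {K L : ℕ} (hKL : 2 * L ≤ K) (f : ℕ → ℝ) {i : ℕ} (hi : i < L) :
    ∑ b ∈ Finset.range K, bandKernel K L f (L - 1 - i) b =
      ∑ j ∈ Finset.range L, f (i + j + 1) + ∑ j ∈ Finset.range (L - i), f (i + j + 1) := by
  obtain ⟨N, rfl⟩ : ∃ N, K = L + (L - i + N) := ⟨K - L - (L - i), by omega⟩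
  rw [Finset.sum_range_add, Finset.sum_range_add, ← Finset.sum_range_reflect _ L]
  have h0 : ∑ x ∈ Finset.range N, bandKernel (L + (L - i + N)) L f (L - 1 - i)
      (L + (L - i + x)) = 0 := by
    refine Finset.sum_eq_zero fun x hx => ?_
    unfold bandKernel
    split_ifs <;> first | omega | rfl
  rw [h0, add_zero]
  congr 1 <;> refine Finset.sum_congr rfl fun j hj => ?_ <;> rw [Finset.mem_range] at hj <;>
    unfold bandKernel <;> split_ifs <;> first | omega | (congr 1; omega)

theorem sum_bandKernel_mid {K L : ℕ} (f : ℕ → ℝ) {a : ℕ} (ha : L ≤ a) (haK : a + L < K) :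
    ∑ b ∈ Finset.range K, bandKernel K L f a b = 2 * ∑ j ∈ Finset.range L, f (j + 1) := by
  obtain ⟨M, rfl⟩ : ∃ M, a = M + L := ⟨a - L, by omega⟩
  obtain ⟨N, rfl⟩ : ∃ N, K = M + (L + (1 + (L + N))) := ⟨K - (M + L + 1 + L), by omega⟩
  rw [Finset.sum_range_add, Finset.sum_range_add, Finset.sum_range_add, Finset.sum_range_add,
    ← Finset.sum_range_reflect _ L, Finset.sum_range_one, two_mul]
  have h0 : ∑ x ∈ Finset.range N, bandKernel (M + (L + (1 + (L + N)))) L f (M + L)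
      (M + (L + (1 + (L + x)))) = 0 := by
    refine Finset.sum_eq_zero fun x hx => ?_
    unfold bandKernel
    split_ifs <;> first | omega | rfl
  have h1 : ∑ x ∈ Finset.range M, bandKernel (M + (L + (1 + (L + N)))) L f (M + L) x = 0 := by
    refine Finset.sum_eq_zero fun x hx => ?_
    rw [Finset.mem_range] at hx
    unfold bandKernel
    split_ifs <;> first | omega | rfl
  have h2 : bandKernel (M + (L + (1 + (L + N)))) L f (M + L) (M + (L + 0)) = 0 := by
    unfold bandKernel
    split_ifs <;> first | omega | rfl
  rw [h0, h1, h2, zero_add, zero_add, add_zero]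
  congr 1 <;> refine Finset.sum_congr rfl fun j hj => ?_ <;> rw [Finset.mem_range] at hj <;>
    unfold bandKernel <;> split_ifs <;> first | omega | (congr 1; omega)

theorem sum_bandKernel_right {K L : ℕ} (hKL : 2 * L ≤ K) (f : ℕ → ℝ) {i : ℕ} (hi : i < L) :
    ∑ b ∈ Finset.range K, bandKernel K L f (K - L + i) b =
      ∑ j ∈ Finset.range L, f (i + j + 1) + ∑ j ∈ Finset.range (L - i), f (i + j + 1) := by
  rw [← sum_bandKernel_left hKL f hi, ← Finset.sum_range_reflect]
  refine Finset.sum_congr rfl fun b hb => ?_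
  rw [Finset.mem_range] at hb
  rw [← bandKernel_reflect hKL f (by omega) hb]
  congr 1; omega

theorem sum_sum_bandKernel {K L : ℕ} (hKL : 2 * L ≤ K) (f : ℕ → ℝ) :
    ∑ a ∈ Finset.range K, ∑ b ∈ Finset.range K, bandKernel K L f a b =
      2 * ∑ i ∈ Finset.range L, (∑ j ∈ Finset.range L, f (i + j + 1) +
        ∑ j ∈ Finset.range (L - i), f (i + j + 1)) +
      ((K : ℝ) - 2 * L) * (2 * ∑ j ∈ Finset.range L, f (j + 1)) := by
  obtain ⟨N, hN⟩ : ∃ N, K = L + (N + L) := ⟨K - 2 * L, by omega⟩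
  set g : ℕ → ℝ := fun a => ∑ b ∈ Finset.range K, bandKernel K L f a b with hg
  have h1 : ∑ a ∈ Finset.range L, g a = ∑ i ∈ Finset.range L,
      (∑ j ∈ Finset.range L, f (i + j + 1) + ∑ j ∈ Finset.range (L - i), f (i + j + 1)) := by
    rw [← Finset.sum_range_reflect]
    exact Finset.sum_congr rfl fun i hi => sum_bandKernel_left hKL f (Finset.mem_range.1 hi)
  have h2 : ∑ x ∈ Finset.range L, g (L + (N + x)) = ∑ i ∈ Finset.range L,
      (∑ j ∈ Finset.range L, f (i + j + 1) + ∑ j ∈ Finset.range (L - i), f (i + j + 1)) := by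
    refine Finset.sum_congr rfl fun i hi => ?_
    rw [← sum_bandKernel_right hKL f (Finset.mem_range.1 hi), hg]
    have : L + (N + i) = K - L + i := by omega
    rw [this]
  have h3 : ∑ x ∈ Finset.range N, g (L + x) = N * (2 * ∑ j ∈ Finset.range L, f (j + 1)) := by
    rw [Finset.sum_congr rfl fun x hx => sum_bandKernel_mid f (Nat.le_add_right L x)
      (by rw [Finset.mem_range] at hx; omega), Finset.sum_const, Finset.card_range, nsmul_eq_mul]
  have h4 : ((K : ℝ) - 2 * L) = N := by rw [hN]; push_cast; ring
  change ∑ a ∈ Finset.range K, g a = _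
  rw [show Finset.range K = Finset.range (L + (N + L)) by rw [hN], Finset.sum_range_add,
    Finset.sum_range_add, h1, h2, h3, h4]
  ring

/-! ### Geometric weights -/

theorem geom_sum_shift {β : ℝ} (hβ : 1 < β) (i m : ℕ) :
    ∑ j ∈ Finset.range m, (β - 1) / (2 * β) * β ^ (i + j + 1) = (β ^ i * β ^ m - β ^ i) / 2 := by
  have hβ' : β - 1 ≠ 0 := (sub_pos.2 hβ).ne'
  have h0 : β ≠ 0 := (zero_lt_one.trans hβ).ne'
  have : ∀ j, (β - 1) / (2 * β) * β ^ (i + j + 1) = (β - 1) * β ^ i / 2 * β ^ j := fun j => by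
    field_simp
    ring
  simp only [this]
  rw [← Finset.mul_sum, geom_sum_eq hβ.ne']
  field_simp

theorem geom_row_left {L : ℕ} {β : ℝ} (hβ : 1 < β) (hβL : β ^ L = 2) {i : ℕ} (hi : i < L) :
    ∑ j ∈ Finset.range L, (β - 1) / (2 * β) * β ^ (i + j + 1) +
      ∑ j ∈ Finset.range (L - i), (β - 1) / (2 * β) * β ^ (i + j + 1) = 1 := by
  have h : β ^ i * β ^ (L - i) = 2 := by rw [← pow_add, Nat.add_sub_cancel' hi.le, hβL]
  rw [geom_sum_shift hβ, geom_sum_shift hβ, h, hβL]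
  ring

theorem geom_row_mid {L : ℕ} {β : ℝ} (hβ : 1 < β) (hβL : β ^ L = 2) :
    2 * ∑ j ∈ Finset.range L, (β - 1) / (2 * β) * β ^ (j + 1) = 1 := by
  have := geom_sum_shift hβ 0 L
  simp only [zero_add, pow_zero, hβL] at this
  rw [this]; norm_num

theorem geom_moment_mid {L : ℕ} {β : ℝ} (hβ : 1 < β) (hβL : β ^ L = 2) :
    2 * ∑ j ∈ Finset.range L, (β - 1) / (2 * β) * β ^ (j + 1) * ((j + 1 : ℕ) : ℝ) =
      2 * L - 1 / (β - 1) := by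
  have hβ' : β - 1 ≠ 0 := (sub_pos.2 hβ).ne'
  have h0 : β ≠ 0 := (zero_lt_one.trans hβ).ne'
  have key : ∀ m : ℕ, 2 * ∑ j ∈ Finset.range m,
      (β - 1) / (2 * β) * β ^ (j + 1) * ((j + 1 : ℕ) : ℝ) =
      (1 - (m + 1) * β ^ m + m * β ^ m * β) / (β - 1) := by
    intro m
    induction m with
    | zero => simp
    | succ m ih =>
      rw [Finset.sum_range_succ, mul_add, ih]
      push_cast
      field_simp
      ring
  rw [key, hβL]
  field_simp
  ring

/-- The exponent `i + j + 1` splits as `(i + 1 / 2) + (j + 1 / 2)`, and the corner weights are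
symmetric in `i` and `j` with unit row sums, so each half contributes
`∑ (i + 1 / 2) = L ^ 2 / 2`. -/
theorem geom_moment_left {L : ℕ} {β : ℝ} (hβ : 1 < β) (hβL : β ^ L = 2) :
    ∑ i ∈ Finset.range L,
      (∑ j ∈ Finset.range L, (β - 1) / (2 * β) * β ^ (i + j + 1) * ((i + j + 1 : ℕ) : ℝ) +
        ∑ j ∈ Finset.range (L - i), (β - 1) / (2 * β) * β ^ (i + j + 1) *
          ((i + j + 1 : ℕ) : ℝ)) = (L : ℝ) ^ 2 := by
  set u : ℕ → ℕ → ℝ := fun i j => (β - 1) / (2 * β) * β ^ (i + j + 1) with hu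
  -- `v` joins both sums into one `L × L` matrix: the second range is `i + j < L`.
  set v : ℕ → ℕ → ℝ := fun i j => u i j + if i + j < L then u i j else 0 with hv
  have hcomm : ∀ i j, v i j = v j i := fun i j => by simp only [hv, hu, add_comm i j]
  have hconv : ∀ (w : ℕ → ℝ) (i : ℕ), i < L →
      ∑ j ∈ Finset.range L, u i j * w j + ∑ j ∈ Finset.range (L - i), u i j * w j =
        ∑ j ∈ Finset.range L, v i j * w j := by
    intro w i hi
    simp only [hv, add_mul, ite_mul, zero_mul, Finset.sum_add_distrib]
    rw [← Finset.sum_filter]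
    congr 2
    ext j
    simp only [Finset.mem_filter, Finset.mem_range]
    omega
  have hrow : ∀ i ∈ Finset.range L, ∑ j ∈ Finset.range L, v i j = 1 := by
    intro i hi
    have h := hconv (fun _ => 1) i (Finset.mem_range.1 hi)
    simp only [mul_one] at h
    rw [← h]
    exact geom_row_left hβ hβL (Finset.mem_range.1 hi)
  have hhalf : ∀ m : ℕ, ∑ i ∈ Finset.range m, ((i : ℝ) + 1 / 2) = (m : ℝ) ^ 2 / 2 := by
    intro m
    induction m with
    | zero => simp
    | succ m ih => rw [Finset.sum_range_succ, ih]; push_cast; ring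
  have h1 : ∑ i ∈ Finset.range L, ∑ j ∈ Finset.range L, v i j * ((i : ℝ) + 1 / 2) =
      (L : ℝ) ^ 2 / 2 := by
    rw [← hhalf]
    refine Finset.sum_congr rfl fun i hi => ?_
    rw [← Finset.sum_mul, hrow i hi, one_mul]
  have h2 : ∑ i ∈ Finset.range L, ∑ j ∈ Finset.range L, v i j * ((j : ℝ) + 1 / 2) =
      (L : ℝ) ^ 2 / 2 := by
    rw [Finset.sum_comm, ← h1]
    simp only [hcomm]
  calc _ = ∑ i ∈ Finset.range L, ∑ j ∈ Finset.range L, v i j * ((i + j + 1 : ℕ) : ℝ) :=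
        Finset.sum_congr rfl fun i hi =>
          hconv (fun j => ((i + j + 1 : ℕ) : ℝ)) i (Finset.mem_range.1 hi)
    _ = (L : ℝ) ^ 2 / 2 + (L : ℝ) ^ 2 / 2 := by
        nth_rewrite 1 [← h1]
        rw [← h2]
        simp only [← Finset.sum_add_distrib, ← mul_add]
        refine Finset.sum_congr rfl fun i _ => Finset.sum_congr rfl fun j _ => ?_
        push_cast
        ring
    _ = _ := by ring

/-- With weights proportional to `β ^ t`, where `β ^ L = 2`, all rows have sum exactly one. -/
theorem sum_bandKernel_geom {K L : ℕ} (hKL : 2 * L ≤ K) {β : ℝ} (hβ : 1 < β) (hβL : β ^ L = 2)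
    {a : ℕ} (ha : a < K) :
    ∑ b ∈ Finset.range K, bandKernel K L (fun t => (β - 1) / (2 * β) * β ^ t) a b = 1 := by
  obtain h | h := lt_or_ge a L
  · obtain ⟨i, hi, rfl⟩ : ∃ i, i < L ∧ a = L - 1 - i := ⟨L - 1 - a, by omega, by omega⟩
    rw [sum_bandKernel_left hKL _ hi, geom_row_left hβ hβL hi]
  obtain h' | h' := lt_or_ge (a + L) K
  · rw [sum_bandKernel_mid _ h h', geom_row_mid hβ hβL]
  · obtain ⟨i, hi, rfl⟩ : ∃ i, i < L ∧ a = K - L + i := ⟨a + L - K, by omega, by omega⟩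
    rw [sum_bandKernel_right hKL _ hi, geom_row_left hβ hβL hi]

/-- The entropy of the geometric band matrix in closed form: `2 * L ^ 2` is the total expected
exponent of the `2 * L` rows that meet a corner, and `2 * L - 1 / (β - 1)` that of any other row. -/
theorem sum_bandKernel_mul_log {K L : ℕ} (hKL : 2 * L ≤ K) {β : ℝ} (hβ : 1 < β)
    (hβL : β ^ L = 2) :
    ∑ a ∈ Finset.range K, ∑ b ∈ Finset.range K,
      bandKernel K L (fun t => (β - 1) / (2 * β) * β ^ t) a b *
        Real.log (bandKernel K L (fun t => (β - 1) / (2 * β) * β ^ t) a b) =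
      K * Real.log ((β - 1) / (2 * β)) +
        Real.log β * (2 * L ^ 2 + (K - 2 * L) * (2 * L - 1 / (β - 1))) := by
  set C := (β - 1) / (2 * β) with hC
  have h0 : 0 < β := zero_lt_one.trans hβ
  have hC0 : 0 < C := div_pos (sub_pos.2 hβ) (by positivity)
  have hlog : ∀ t : ℕ, C * β ^ t * Real.log (C * β ^ t) =
      C * β ^ t * Real.log C + C * β ^ t * t * Real.log β := by
    intro t
    rw [Real.log_mul hC0.ne' (by positivity), Real.log_pow]
    ring
  simp only [map_bandKernel (g := fun x => x * Real.log x) (by simp)]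
  rw [sum_sum_bandKernel hKL]
  simp only [hlog, Finset.sum_add_distrib, ← Finset.sum_mul]
  have h1 : ∑ i ∈ Finset.range L, ∑ j ∈ Finset.range L, C * β ^ (i + j + 1) +
      ∑ i ∈ Finset.range L, ∑ j ∈ Finset.range (L - i), C * β ^ (i + j + 1) = L := by
    rw [← Finset.sum_add_distrib, Finset.sum_congr rfl fun i hi =>
      geom_row_left hβ hβL (Finset.mem_range.1 hi)]
    simp
  have h2 := geom_row_mid hβ hβL
  have h3 := geom_moment_left hβ hβL
  have h4 := geom_moment_mid hβ hβL
  rw [Finset.sum_add_distrib] at h3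
  rw [← hC] at h2 h3 h4
  linear_combination 2 * Real.log C * h1 + (K - 2 * L) * Real.log C * h2 +
    2 * Real.log β * h3 + (K - 2 * L) * Real.log β * h4

/-! ### Fine partitions -/

theorem tendsto_mul_two_rpow_sub_one :
    Tendsto (fun x : ℝ => x * ((2 : ℝ) ^ (1 / x) - 1)) atTop (nhds (Real.log 2)) := by
  have h := (Real.hasStrictDerivAt_const_rpow (a := 2) (by norm_num) 0).hasDerivAt
  rw [Real.rpow_zero, one_mul, hasDerivAt_iff_tendsto_slope_zero] at h
  have h1 : Tendsto (fun x : ℝ => x⁻¹) atTop (nhdsWithin 0 {0}ᶜ) :=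
    tendsto_inv_atTop_nhdsGT_zero.mono_right (nhdsWithin_mono _ fun x hx => ne_of_gt hx)
  refine (h.comp h1).congr fun x => ?_
  simp

/-- When the bandwidth is asymptotically `ρ * K`, the bound of `eventually_le_log_card_permBall` for
the geometric band matrix converges to the constant of the theorem, in natural logarithms. -/
theorem tendsto_band_entropy {ρ : ℝ} (hρ : 0 < ρ) {L : ℕ → ℕ} (hL : Tendsto L atTop atTop)
    (hLK : Tendsto (fun K : ℕ => (L K : ℝ) / K) atTop (nhds ρ)) {β : ℕ → ℝ}
    (hβ : ∀ K, β K = (2 : ℝ) ^ (1 / (L K : ℝ))) :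
    Tendsto (fun K : ℕ => 1 + Real.log K + (K * Real.log ((β K - 1) / (2 * β K)) +
        Real.log (β K) * (2 * L K ^ 2 + (K - 2 * L K) * (2 * L K - 1 / (β K - 1)))) / K) atTop
      (nhds ((1 - Real.log 2) * (2 * ρ) - Real.log ρ + Real.log (Real.log 2) + Real.log 2)) := by
  have hln2 : 0 < Real.log 2 := Real.log_pos one_lt_two
  have hLr : Tendsto (fun K => (L K : ℝ)) atTop atTop := tendsto_natCast_atTop_atTop.comp hL
  have hD : Tendsto (fun K => L K * (β K - 1)) atTop (nhds (Real.log 2)) := by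
    simp only [hβ]
    exact tendsto_mul_two_rpow_sub_one.comp hLr
  have hβ1 : Tendsto β atTop (nhds 1) := by
    have h : Tendsto (fun K => (L K : ℝ)⁻¹ * (L K * (β K - 1)) + 1) atTop (nhds 1) := by
      simpa using ((tendsto_inv_atTop_zero.comp hLr).mul hD).add_const 1
    refine h.congr' ?_
    filter_upwards [hL.eventually_gt_atTop 0] with K hK
    field_simp
    ring
  -- The expression is rearranged so that it depends only on `L (β - 1) → log 2`, `β → 1` and
  -- `L / K → ρ`, using `L * log β = log 2`.
  have hmain := (((hD.div (hβ1.const_mul 2) (by norm_num)).div hLK hρ.ne').log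
      (by rw [mul_one]; positivity)).add
    (((hLK.const_mul 2).mul_const (Real.log 2)).add
      (((hLK.const_mul 2).const_sub 1).mul
        (((tendsto_const_nhds (x := Real.log 2)).div hD hln2.ne').const_sub (2 * Real.log 2))))
  have hlim : Real.log (Real.log 2 / (2 * 1) / ρ) + (2 * ρ * Real.log 2 +
      (1 - 2 * ρ) * (2 * Real.log 2 - Real.log 2 / Real.log 2)) + 1 =
      (1 - Real.log 2) * (2 * ρ) - Real.log ρ + Real.log (Real.log 2) + Real.log 2 := by
    rw [div_self hln2.ne', mul_one, Real.log_div (by positivity) hρ.ne',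
      Real.log_div hln2.ne' two_ne_zero]
    ring
  have hmain := hmain.add_const 1
  rw [hlim] at hmain
  refine hmain.congr' ?_
  filter_upwards [hL.eventually_gt_atTop 0, eventually_gt_atTop 0] with K hLK hK
  have hL0 : (0 : ℝ) < L K := by exact_mod_cast hLK
  have hK0 : (0 : ℝ) < K := by exact_mod_cast hK
  have hβgt : 1 < β K := by rw [hβ]; exact Real.one_lt_rpow one_lt_two (by positivity)
  have hb : 0 < β K - 1 := sub_pos.2 hβgt
  have hb0 : 0 < β K := zero_lt_one.trans hβgt
  have hlogβ : Real.log (β K) = Real.log 2 / L K := by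
    rw [hβ, Real.log_rpow two_pos]; ring
  have harg : L K * (β K - 1) / (2 * β K) / (L K / K) = K * ((β K - 1) / (2 * β K)) := by
    field_simp
  rw [hlogβ]
  simp only [Pi.div_apply]
  rw [harg, Real.log_mul hK0.ne' (by positivity)]
  field_simp
  ring

theorem eventually_le_log_card_permBall_entropy {ρ : ℝ} (hρ0 : 0 < ρ) (hρ : ρ ≤ 1 / 2) {ε : ℝ}
    (hε : 0 < ε) :
    ∀ᶠ n : ℕ in atTop, ∀ r : ℕ, (r : ℝ) = ρ * ((n : ℝ) - 1) →
      n * Real.log n - n * ((1 - Real.log 2) * (2 * ρ) - Real.log ρ + Real.log (Real.log 2) +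
        Real.log 2 + ε) ≤ Real.log (permBall r (1 : Equiv.Perm (Fin n))).card := by
  -- The largest bandwidth for which `L + 1 ≤ ρ * K`, as `natAbs_sub_le_of_blockIndex` requires.
  set L : ℕ → ℕ := fun K => ⌊ρ * K⌋₊ - 1 with hLdef
  have hfl : Tendsto (fun K : ℕ => ⌊ρ * K⌋₊) atTop atTop :=
    tendsto_nat_floor_atTop.comp (tendsto_natCast_atTop_atTop.const_mul_atTop hρ0)
  have hL : Tendsto L atTop atTop := (tendsto_sub_atTop_nat 1).comp hfl
  have hpos := hL.eventually_gt_atTop 0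
  have hLle : ∀ᶠ K : ℕ in atTop, (L K : ℝ) + 1 ≤ ρ * K ∧ ρ * K < L K + 2 := by
    filter_upwards [hpos] with K hK
    have h0 : (0 : ℝ) ≤ ρ * K := by positivity
    have h1 : L K + 1 = ⌊ρ * K⌋₊ := by simp only [hLdef] at hK ⊢; omega
    have h2 : (L K : ℝ) + 1 = ⌊ρ * K⌋₊ := by exact_mod_cast h1
    exact ⟨h2 ▸ Nat.floor_le h0, by linarith [Nat.lt_floor_add_one (ρ * K)]⟩
  have hLK : Tendsto (fun K : ℕ => (L K : ℝ) / K) atTop (nhds ρ) :=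
    tendsto_div_of_abs_sub_le (C := 2) <| by
      filter_upwards [hLle] with K hK
      rw [abs_le]
      constructor <;> linarith [hK.1, hK.2]
  have hent := tendsto_band_entropy hρ0 hL hLK (β := fun K => (2 : ℝ) ^ (1 / (L K : ℝ)))
    fun _ => rfl
  obtain ⟨K, hKe, hL0, hKL, hK0⟩ := ((hent.eventually (gt_mem_nhds
    (lt_add_of_pos_right _ (half_pos hε)))).and (hpos.and (hLle.and
      (eventually_gt_atTop 0)))).exists
  have hK' : (0 : ℝ) < K := by exact_mod_cast hK0
  have h2L : 2 * L K ≤ K := by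
    have : (2 * L K : ℝ) ≤ K := by nlinarith [hKL.1]
    exact_mod_cast this
  have hLr : (0 : ℝ) < L K := by exact_mod_cast hL0
  set β : ℝ := (2 : ℝ) ^ (1 / (L K : ℝ)) with hβdef
  have hβ : 1 < β := Real.one_lt_rpow one_lt_two (by positivity)
  have hβL : β ^ L K = 2 := by
    rw [hβdef, ← Real.rpow_natCast, ← Real.rpow_mul two_pos.le, one_div_mul_cancel hLr.ne',
      Real.rpow_one]
  set f : ℕ → ℝ := fun t => (β - 1) / (2 * β) * β ^ t with hf
  have hf0 : ∀ t, 0 ≤ f t := fun t => by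
    have : 0 < β - 1 := sub_pos.2 hβ
    positivity
  have hsum := sum_bandKernel_mul_log h2L hβ hβL
  have hev := eventually_le_log_card_permBall hK0
    (W := fun a b => bandKernel K (L K) f a b) (fun a b => bandKernel_nonneg hf0 a b)
    (fun a => by
      rw [Fin.sum_univ_eq_sum_range (fun b => bandKernel K (L K) f a b)]
      exact sum_bandKernel_geom h2L hβ hβL a.2)
    (fun a b => bandKernel_comm _ _ _ _ _)
    (fun a b h => abs_sub_le_of_bandKernel_ne_zero a.2 b.2 h)
    (by linarith) hKL.1 (half_pos hε)
  have hsum' : ∑ a : Fin K, ∑ b : Fin K, bandKernel K (L K) f a b *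
      Real.log (bandKernel K (L K) f a b) = ∑ a ∈ Finset.range K, ∑ b ∈ Finset.range K,
        bandKernel K (L K) f a b * Real.log (bandKernel K (L K) f a b) := by
    rw [← Fin.sum_univ_eq_sum_range (fun a => ∑ b ∈ Finset.range K,
      bandKernel K (L K) f a b * Real.log (bandKernel K (L K) f a b))]
    exact Finset.sum_congr rfl fun a _ => Fin.sum_univ_eq_sum_range (fun b =>
      bandKernel K (L K) f a b * Real.log (bandKernel K (L K) f a b)) K
  rw [hsum', hsum] at hev
  filter_upwards [hev] with n hn r hr
  refine le_trans ?_ (hn r hr)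
  exact sub_le_sub_left (mul_le_mul_of_nonneg_left (by linarith) (Nat.cast_nonneg n)) _

theorem mainTheorem3 (ρ : ℝ) (hρ0 : 0 < ρ) (hρ : ρ ≤ 1 / 2) :
    ∃ φ₃ : ℕ → ℝ,
      (∀ n, 0 < φ₃ n) ∧
      (fun n : ℕ => Real.logb 2 (φ₃ n) -
          ((n : ℝ) * Real.logb 2 (n : ℝ) -
            (n : ℝ) * ((Real.logb 2 (Real.exp 1) - 1) * (2 * ρ) - Real.logb 2 ρ -
              Real.logb 2 (Real.logb 2 (Real.exp 1)) + 1)))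
        =o[atTop] (fun n : ℕ => (n : ℝ)) ∧
      ∀ (n r : ℕ), 1 ≤ n → (r : ℝ) = ρ * ((n : ℝ) - 1) →
        ∀ f : Equiv.Perm (Fin n), φ₃ n ≤ ((permBall r f).card : ℝ) := by
  classical
  have hln2 : 0 < Real.log 2 := Real.log_pos one_lt_two
  set G : ℕ → ℝ := fun n => (n : ℝ) * Real.logb 2 (n : ℝ) -
    (n : ℝ) * ((Real.logb 2 (Real.exp 1) - 1) * (2 * ρ) - Real.logb 2 ρ -
      Real.logb 2 (Real.logb 2 (Real.exp 1)) + 1) with hG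
  set A : ℕ → ℕ := fun n => (permBall ⌊ρ * ((n : ℝ) - 1)⌋₊ (1 : Equiv.Perm (Fin n))).card with hA
  have hApos : ∀ n, (0 : ℝ) < A n := fun n => by
    have : (1 : Equiv.Perm (Fin n)) ∈ permBall ⌊ρ * ((n : ℝ) - 1)⌋₊ (1 : Equiv.Perm (Fin n)) := by
      simp [mem_permBall_one]
    exact Nat.cast_pos.2 (Finset.card_pos.2 ⟨_, this⟩)
  have h2G : ∀ n, (0 : ℝ) < 2 ^ G n := fun n => Real.rpow_pos_of_pos two_pos _
  have hlogG : ∀ n, Real.logb 2 (2 ^ G n) = G n := fun n =>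
    Real.logb_rpow two_pos (by norm_num)
  -- Taking the minimum with the size of the ball removes the error term, which is `o(n)` because of
  -- the entropy bound. If `ρ * (n - 1)` is not an integer, only the asymptotics matter.
  refine ⟨fun n => if (⌊ρ * ((n : ℝ) - 1)⌋₊ : ℝ) = ρ * ((n : ℝ) - 1) then min (2 ^ G n) (A n)
    else 2 ^ G n, fun n => ?_, ?_, fun n r hn hr f => ?_⟩
  · dsimp only
    split_ifs
    · exact lt_min (h2G n) (hApos n)
    · exact h2G n
  · rw [isLittleO_iff]
    intro ε hε
    filter_upwards [eventually_le_log_card_permBall_entropy hρ0 hρ (mul_pos hε hln2)] with n hn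
    rw [Real.norm_eq_abs, Real.norm_eq_abs, Nat.abs_cast]
    split_ifs with h
    · have h1 : G n - ε * n ≤ Real.logb 2 (A n) := by
        have h2 := hn _ h
        have h3 : (G n - ε * n) * Real.log 2 ≤ Real.log (A n) := by
          convert h2 using 1
          simp only [hG, Real.logb, Real.log_exp]
          rw [Real.log_div one_ne_zero hln2.ne', Real.log_one]
          field_simp
          ring
        rw [Real.logb, le_div_iff₀ hln2]
        exact h3
      have h4 : 0 ≤ ε * n := by positivity
      obtain h5 | h5 := le_total ((2 : ℝ) ^ G n) (A n)
      · rw [min_eq_left h5, hlogG, sub_self, abs_zero]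
        exact h4
      · rw [min_eq_right h5]
        have h6 : Real.logb 2 (A n) ≤ G n := by
          rw [← hlogG n]
          exact Real.logb_le_logb_of_le one_lt_two (hApos n) h5
        rw [abs_le]
        constructor <;> linarith
    · rw [hlogG, sub_self, abs_zero]
      positivity
  · have hfl : ⌊ρ * ((n : ℝ) - 1)⌋₊ = r := by rw [← hr, Nat.floor_natCast]
    dsimp only
    rw [if_pos (by rw [hfl, hr]), card_permBall_eq r f]
    refine (min_le_right _ _).trans ?_
    simp only [hA, hfl, le_refl]
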